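/- Let $(\Omega,m)$ be a $\sigma$-finite measure space and $\mathcal H$ a separable complex Hilbert space. A set $\mathcal D\subseteq L^\infty(\Omega)$ is a *determining set* for $L^1(\Omega)$ if $f\in L^1(\Omega)$ and $\int_\Omega fg\,dm=0$ for all $g\in\mathcal D$ imply $f=0$. For $\mathcal E\subseteq L^\infty(\Omega)$, a closed subspace $W\subseteq L^2(\Omega,\mathcal H)$ is *multiplicatively invariant* with respect to $\mathcal E$ if $g\phi\in W$ for all $\phi\in W$, $g\in\mathcal E$. A *range function* $J$ assigns to each $\omega\in\Omega$ a closed subspace $J(\omega)$ of $\mathcal H$; with $P_J(\omega)$ the orthogonal projection of $\mathcal H$ onto $J(\omega)$, it is measurable if $\omega\mapsto\langle P_J(\omega)a,b\rangle$ is measurable for all $a,b\in\mathcal H$. It *corresponds* to $W$ if $W=\{\phi\in L^2(\Omega,\mathcal H):\phi(\omega)\in J(\omega)\text{ for a.e. }\omega\}$. A *range operator* $R$ on $J$ assigns to each $\omega$ a bounded linear operator $R(\omega):J(\omega)\to\mathcal H$; it is measurable if $\omega\mapsto\langle R(\omega)P_J(\omega)a,b\rangle$ is measurable for all $a,b\in\mathcal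 H$. A bounded linear operator $U:W\to L^2(\Omega,\mathcal H)$ is *multiplication preserving* with respect to $\mathcal E$ if $W$ is multiplicatively invariant with respect to $\mathcal E$ and $U(g\phi)=g\,U\phi$ for all $g\in\mathcal E$, $\phi\in W$. **Theorem.** Let $\mathcal D$ be a determining set for $L^1(\Omega)$ and let $W\subseteq L^2(\Omega,\mathcal H)$ be a closed subspace which is multiplicatively invariant with respect to $\mathcal D$. Then there is a measurable range function corresponding to $W$. Let $J$ be any such range function. (a) For every bounded linear operator $U:W\to L^2(\Omega,\mathcal H)$ the following are equivalent: 1. $U$ is multiplication preserving with respect to $\mathcal D$. 2. $U$ is multiplication preserving with respect to $L^\infty(\Omega)$. 3. There is a measurable range operator $R$ on $J$ such that for all $\phi\in W$, $$U\phi(\omega)=R(\omega)(\phi(\omega))\quad\text{for a.e. }\omega\in\Omega.\qquad(*)$$ (b) Conversely, for every measurable range operator $R$ on $J$ with $\operatorname{ess\,sup}_{\omega}\|R(\omega)\|<\infty$ there is a bounded linear operator $U:W\to L^2(\Omega,\mathcal H)$, multiplication preserving with respect to $\mathcal D$, such that $(*)$ holds for all $\phi\in W$. (c) The correspondence is one to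 one when range operators equal a.e. are identified: if bounded linear operators $U,U'$ and measurable range operators $R,R'$ on $J$ are related by $(*)$ respectively, then $U=U'$ if and only if $R(\omega)=R'(\omega)$ for a.e. $\omega$. (d) If a bounded linear operator $U$ and a measurable range operator $R$ on $J$ are related by $(*)$, then $\|U\|=\operatorname{ess\,sup}_{\omega\in\Omega}\|R(\omega)\|$. -/

import Mathlib

open MeasureTheory
open scoped ENNReal

namespace MulInvariant

section

variable {Ω H : Type*} [MeasurableSpace Ω] {μ : Measure Ω}
  [NormedAddCommGroup H] [InnerProductSpace ℂ H]

/-- A set `D ⊆ L^∞(Ω)` is a determining set for `L^1(Ω)` if the only `f ∈ L^1(Ω)` with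
`∫ f g = 0` for all `g ∈ D` is `f = 0`. -/
def IsDetermining (D : Set (Lp ℂ ∞ μ)) : Prop :=
  ∀ f : Lp ℂ 1 μ, (∀ g ∈ D, ∫ ω, f ω * g ω ∂μ = 0) → f = 0

/-- The closed subspace `W ⊆ L²(Ω, H)` is multiplicatively invariant with respect to `D`:
`g φ ∈ W` for all `φ ∈ W` and `g ∈ D`. Here `g • φ` is Mathlib's pointwise product
`L^∞(Ω) × L²(Ω, H) → L²(Ω, H)`. -/
def IsMulInvariant (D : Set (Lp ℂ ∞ μ)) (W : ClosedSubmodule ℂ (Lp H 2 μ)) : Prop :=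
  ∀ φ ∈ W.toSubmodule, ∀ g ∈ D, (g • φ : Lp H 2 μ) ∈ W.toSubmodule

/-- A bounded operator `U : W → L²(Ω, H)` is multiplication preserving with respect to `D`:
`W` is multiplicatively invariant with respect to `D`, and `U (g φ) = g (U φ)` for all
`g ∈ D` and `φ ∈ W`. -/
def IsMulPreserving (D : Set (Lp ℂ ∞ μ)) {W : ClosedSubmodule ℂ (Lp H 2 μ)}
    (U : W.toSubmodule →L[ℂ] Lp H 2 μ) : Prop :=
  ∃ hW : IsMulInvariant D W, ∀ g (hg : g ∈ D) (φ : W.toSubmodule),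
    U ⟨(g • (φ : Lp H 2 μ) : Lp H 2 μ), hW φ φ.2 g hg⟩ = (g • U φ : Lp H 2 μ)

/-- `J` is the range function of `W`: `W = {φ ∈ L²(Ω, H) : φ(ω) ∈ J(ω) for a.e. ω}`. -/
def IsRangeFunctionOf (J : Ω → ClosedSubmodule ℂ H)
    (W : ClosedSubmodule ℂ (Lp H 2 μ)) : Prop :=
  ∀ φ : Lp H 2 μ, φ ∈ W.toSubmodule ↔ ∀ᵐ ω ∂μ, φ ω ∈ (J ω).toSubmodule

/-- A range operator on the range function `J`: a family of bounded operators
`R(ω) : J(ω) → H`. -/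
abbrev RangeOperator (J : Ω → ClosedSubmodule ℂ H) : Type _ :=
  ∀ ω, (J ω).toSubmodule →L[ℂ] H

/-- `U` is given by `R`: for all `φ ∈ W`, `(U φ)(ω) = R(ω) (φ(ω))` for a.e. `ω`
(in particular `φ(ω)` lies in the domain `J(ω)` of `R(ω)` for a.e. `ω`). -/
def IsGivenBy {W : ClosedSubmodule ℂ (Lp H 2 μ)} (U : W.toSubmodule →L[ℂ] Lp H 2 μ)
    {J : Ω → ClosedSubmodule ℂ H} (R : RangeOperator J) : Prop :=
  ∀ φ : W.toSubmodule, ∀ᵐ ω ∂μ,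
    ∃ h : (φ : Lp H 2 μ) ω ∈ (J ω).toSubmodule, U φ ω = R ω ⟨(φ : Lp H 2 μ) ω, h⟩

variable [CompleteSpace H]

/-- A range function `J` is measurable if `ω ↦ ⟨P_J(ω) a, b⟩` is measurable for all `a, b ∈ H`,
where `P_J(ω)` is the orthogonal projection of `H` onto `J(ω)`. -/
def IsMeasurableRangeFunction (J : Ω → ClosedSubmodule ℂ H) : Prop :=
  ∀ a b : H, Measurable fun ω =>
    inner ℂ b ((J ω).toSubmodule.orthogonalProjectionOnto a : H)

/-- A range operator `R` on `J` is measurable if `ω ↦ ⟨R(ω) P_J(ω) a, b⟩` is measurable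
for all `a, b ∈ H`. -/
def IsMeasurableRangeOperator {J : Ω → ClosedSubmodule ℂ H} (R : RangeOperator J) : Prop :=
  ∀ a b : H, Measurable fun ω =>
    inner ℂ b (R ω ((J ω).toSubmodule.orthogonalProjectionOnto a))

end

end MulInvariant

namespace MulInvariant

open Filter Topology

section

/-! For `φ ∈ W` and `ψ ⊥ W`, invariance says that the integrable function `⟨ψ, φ⟩` integrates to
zero against every `g ∈ D`. As `D` is determining, `φ` and `ψ` are orthogonal at almost every point
(`IsMulInvariant.ae_inner_eq_zero`). Since `W = Wᗮᗮ`, this turns invariance under `D` into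
invariance under all of `L^∞`; the same argument with the adjoint handles operators
(`IsMulPreserving.univ`).

To work pointwise, fix a strictly positive `h ∈ L²` and a dense sequence `d n` of `H`. Projecting `h
• d n` onto `W` gives countably many functions whose values span `J ω`, and `h⁻¹` times them is the
projection of `d n` onto `J ω` (`exists_rangeFunction`).

Indicator multipliers localise the bound on `U` to `‖U φ ω‖ ≤ ‖U‖ * ‖φ ω‖` a.e.
(`norm_apply_le_of_isMulPreserving`). Applied to countably many combinations of the functions `h P_J
(d n)`, it lets `R ω` be defined by density off a null set (`exists_rangeOperator`). Testing on
these functions also gives uniqueness and the norm formula. -/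

/-- An assignment on a dense sequence that is additive and homogeneous up to the obvious errors
extends to a bounded operator. -/
theorem exists_continuousLinearMap_of_denseRange {E F : Type*} [NormedAddCommGroup E]
    [NormedSpace ℂ E] [NormedAddCommGroup F] [NormedSpace ℂ F] [CompleteSpace F]
    {d : ℕ → E} (hd : DenseRange d) (f : ℕ → F) (C : ℝ)
    (h : ∀ c ∈ ({0, 1, Complex.I} : Set ℂ), ∀ n m k,
      ‖f n + c • f m - f k‖ ≤ C * ‖d n + c • d m - d k‖) :
    ∃ T : E →L[ℂ] F, ∀ n, T (d n) = f n := by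
  have hseq (x : E) : ∃ s : ℕ → ℕ, Tendsto (fun k => d (s k)) atTop (𝓝 x) := by
    obtain ⟨u, hu, hx⟩ := mem_closure_iff_seq_limit.1 (hd x)
    choose s hs using hu
    exact ⟨s, by simpa only [hs] using hx⟩
  choose s hs using hseq
  -- Three scalars suffice: `0` gives the Lipschitz bound, `1` additivity and `I` commutation with
  -- `I`; real homogeneity then follows from additivity and continuity.
  have hlip n m : ‖f n - f m‖ ≤ C * ‖d n - d m‖ := by simpa using h 0 (by simp) n 0 m
  have hlim (x : E) : ∃ y, Tendsto (fun k => f (s x k)) atTop (𝓝 y) := by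
    obtain ⟨b, hb0, hb, hb'⟩ := cauchySeq_iff_le_tendsto_0.1 (hs x).cauchySeq
    refine cauchySeq_tendsto_of_complete ?_
    refine cauchySeq_of_le_tendsto_0 (fun N => |C| * b N) (fun n m N hn hm => ?_)
      (by simpa using hb'.const_mul |C|)
    rw [dist_eq_norm]
    refine (hlip _ _).trans ?_
    rw [← dist_eq_norm]
    exact mul_le_mul (le_abs_self C) (hb n m N hn hm) dist_nonneg (abs_nonneg C)
  choose T hT using hlim
  have key (c : ℂ) (hc : c ∈ ({0, 1, Complex.I} : Set ℂ)) (x y z : E) :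
      ‖T x + c • T y - T z‖ ≤ C * ‖x + c • y - z‖ :=
    le_of_tendsto_of_tendsto' (((hT x).add ((hT y).const_smul c)).sub (hT z)).norm
      ((((hs x).add ((hs y).const_smul c)).sub (hs z)).norm.const_mul C)
      fun k => h c hc _ _ _
  have hadd (x y : E) : T (x + y) = T x + T y := by
    have := key 1 (by simp) x y (x + y)
    simp only [one_smul, sub_self, norm_zero, mul_zero] at this
    exact (sub_eq_zero.1 (norm_le_zero_iff.1 this)).symm
  have hT0 : T 0 = 0 := by simpa using hadd 0 0
  have hI (x : E) : T (Complex.I • x) = Complex.I • T x := by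
    have := key Complex.I (by simp) 0 x (Complex.I • x)
    simp only [hT0, zero_add, sub_self, norm_zero, mul_zero] at this
    exact (sub_eq_zero.1 (norm_le_zero_iff.1 this)).symm
  have hcont : Continuous T := by
    refine (LipschitzWith.of_dist_le_mul (K := Real.toNNReal C) fun x y => ?_).continuous
    rw [dist_eq_norm, dist_eq_norm]
    have := key 0 (by simp) x 0 y
    simp only [zero_smul, add_zero] at this
    exact this.trans (mul_le_mul_of_nonneg_right (Real.le_coe_toNNReal C) (norm_nonneg _))
  let A : E →+ F := ⟨⟨T, hT0⟩, hadd⟩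
  have hreal (r : ℝ) (x : E) : T (r • x) = r • T x := map_real_smul A hcont r x
  refine ⟨⟨⟨⟨T, hadd⟩, fun c x => ?_⟩, hcont⟩, fun n => ?_⟩
  · change T (c • x) = c • T x
    conv_lhs => rw [← Complex.re_add_im c, add_smul, mul_smul]
    conv_rhs => rw [← Complex.re_add_im c, add_smul, mul_smul]
    rw [hadd]
    simp only [Complex.coe_smul, hreal, hI]
  · change T (d n) = f n
    have h1 : Tendsto (fun k => ‖f (s (d n) k) - f n‖) atTop (𝓝 0) := by
      refine squeeze_zero (fun _ => norm_nonneg _) (fun k => hlip _ _) ?_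
      simpa using ((hs (d n)).sub_const (d n)).norm.const_mul C
    exact tendsto_nhds_unique (hT (d n)) (tendsto_iff_norm_sub_tendsto_zero.2 h1)

variable {Ω H : Type*} [MeasurableSpace Ω] {μ : Measure Ω}
  [NormedAddCommGroup H] [InnerProductSpace ℂ H]

/-- Weak measurability of a family of bounded operators can be checked on a dense sequence. -/
theorem measurable_inner_apply_of_denseRange {E : Type*} [NormedAddCommGroup E] [NormedSpace ℂ E]
    {F : Ω → E →L[ℂ] H} {d : ℕ → E} (hd : DenseRange d)
    (hF : ∀ n (b : H), Measurable fun ω => inner ℂ b (F ω (d n))) (a : E) (b : H) :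
    Measurable fun ω => inner ℂ b (F ω a) := by
  obtain ⟨u, hu, hx⟩ := mem_closure_iff_seq_limit.1 (hd a)
  choose s hs using hu
  refine measurable_of_tendsto_metrizable (fun k => hF (s k) b) (tendsto_pi_nhds.2 fun ω => ?_)
  simp only [hs]
  exact ((continuous_const.inner (F ω).continuous).tendsto a).comp hx

section Measurability

variable [CompleteSpace H] [TopologicalSpace.SeparableSpace H]

/-- In a separable Hilbert space weakly measurable functions are strongly measurable. -/
theorem stronglyMeasurable_of_inner {f : Ω → H}
    (hf : ∀ b : H, Measurable fun ω => inner ℂ b (f ω)) : StronglyMeasurable f := by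
  borelize H
  let Φ : H → ℕ → ℂ := fun x n => inner ℂ (TopologicalSpace.denseSeq H n) x
  have hΦ : Continuous Φ := by fun_prop
  have hinj : Function.Injective Φ := fun x y hxy => by
    have h0 : (fun b : H => inner ℂ b x) = fun b => inner ℂ b y :=
      (TopologicalSpace.denseRange_denseSeq H).equalizer (by fun_prop) (by fun_prop)
        (funext fun n => congrFun hxy n)
    exact ext_inner_left ℂ fun b => congrFun h0 b
  have : Measurable f :=
    -- Lusin–Souslin: a continuous injection of the Polish space `H` is a measurable embedding.
    (hΦ.measurableEmbedding hinj).measurable_comp_iff.1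
      (measurable_pi_lambda _ fun n => hf _)
  exact this.stronglyMeasurable

/-- Carathéodory functions, continuous in the vector and measurable in `ω`, are jointly measurable.
-/
theorem stronglyMeasurable_apply {F : Ω → H →L[ℂ] H}
    (hF : ∀ a b : H, Measurable fun ω => inner ℂ b (F ω a)) {φ : Ω → H}
    (hφ : StronglyMeasurable φ) : StronglyMeasurable fun ω => F ω (φ ω) := by
  borelize H
  have := stronglyMeasurable_uncurry_of_continuous_of_stronglyMeasurable
    (u := fun (a : H) (ω : Ω) => F ω a) (fun ω => (F ω).continuous)
    (fun a => stronglyMeasurable_of_inner (hF a))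
  exact this.comp_measurable (hφ.measurable.prodMk measurable_id)

end Measurability

/-- A `σ`-finite measure carries a strictly positive square integrable function. -/
theorem exists_pos_memLp_two (μ : Measure Ω) [SigmaFinite μ] :
    ∃ h : Ω → ℝ, Measurable h ∧ (∀ ω, 0 < h ω) ∧ MemLp h 2 μ := by
  obtain ⟨g, hpos, hg, hint⟩ := exists_pos_lintegral_lt_of_sigmaFinite μ one_ne_zero
  refine ⟨fun ω => Real.sqrt (g ω), by fun_prop, fun ω => Real.sqrt_pos.2 (hpos ω), ?_⟩
  rw [memLp_two_iff_integrable_sq (by fun_prop)]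
  simp only [Real.sq_sqrt (NNReal.coe_nonneg _)]
  refine ⟨by fun_prop, ?_⟩
  rw [hasFiniteIntegral_iff_enorm]
  simpa using hint.trans ENNReal.one_lt_top

theorem IsDetermining.ae_eq_zero {D : Set (Lp ℂ ∞ μ)} (hD : IsDetermining D) {f : Ω → ℂ}
    (hf : Integrable f μ) (h : ∀ g ∈ D, ∫ ω, f ω * g ω ∂μ = 0) : f =ᵐ[μ] 0 := by
  have hcoe := hf.coeFn_toL1
  have : hf.toL1 f = 0 := hD _ fun g hg => by
    rw [← h g hg]
    refine integral_congr_ae ?_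
    filter_upwards [hcoe] with ω hω
    rw [hω]
  rw [this] at hcoe
  exact hcoe.symm.trans (Lp.coeFn_zero ℂ 1 μ)

theorem inner_lpSMul (g : Lp ℂ ∞ μ) (φ ψ : Lp H 2 μ) :
    inner ℂ ψ (g • φ : Lp H 2 μ) = ∫ ω, inner ℂ (ψ ω) (φ ω) * g ω ∂μ := by
  rw [L2.inner_def]
  refine integral_congr_ae ?_
  filter_upwards [Lp.coeFn_lpSMul (r := 2) g φ] with ω hω
  rw [hω, Pi.smul_apply', inner_smul_right, mul_comm]

theorem integral_inner_mul_eq_zero_of_ae {φ ψ : Lp H 2 μ} (g : Ω → ℂ)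
    (h : ∀ᵐ ω ∂μ, inner ℂ (ψ ω) (φ ω) = 0) : ∫ ω, inner ℂ (ψ ω) (φ ω) * g ω ∂μ = 0 := by
  refine integral_eq_zero_of_ae ?_
  filter_upwards [h] with ω hω
  simp [hω]

theorem inner_eq_zero_of_ae {φ ψ : Lp H 2 μ}
    (h : ∀ᵐ ω ∂μ, inner ℂ (ψ ω) (φ ω) = 0) : inner ℂ ψ φ = 0 := by
  rw [L2.inner_def]
  exact integral_eq_zero_of_ae h

/-- The multiplier `1_s`. -/
theorem exists_indicator_mul {s : Set Ω} (hs : MeasurableSet s) :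
    ∃ g : Lp ℂ ∞ μ, ∀ φ : Lp H 2 μ, ((g • φ : Lp H 2 μ) : Ω → H) =ᵐ[μ] s.indicator φ := by
  have hm : MemLp (s.indicator fun _ => (1 : ℂ)) ∞ μ :=
    (memLp_top_const (1 : ℂ)).indicator hs
  refine ⟨hm.toLp _, fun φ => ?_⟩
  filter_upwards [Lp.coeFn_lpSMul (r := 2) (hm.toLp _) φ, hm.coeFn_toLp] with ω h1 h2
  rw [h1, Pi.smul_apply', h2]
  by_cases h : ω ∈ s <;> simp [h]

theorem enorm_sq_eq_lintegral {E : Type*} [NormedAddCommGroup E] (φ : Lp E 2 μ) : ‖φ‖ₑ ^ 2 = ∫⁻ ω, ‖φ ω‖ₑ ^ 2 ∂μ := by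
  rw [Lp.enorm_def, eLpNorm_eq_lintegral_rpow_enorm_toReal (by norm_num) (by norm_num)]
  rw [← ENNReal.rpow_natCast, ← ENNReal.rpow_mul]
  simp

theorem enorm_sq_eq_setLIntegral {E : Type*} [NormedAddCommGroup E] {φ ψ : Lp E 2 μ} {s : Set Ω} (hs : MeasurableSet s)
    (h : (ψ : Ω → E) =ᵐ[μ] s.indicator φ) : ‖ψ‖ₑ ^ 2 = ∫⁻ ω in s, ‖φ ω‖ₑ ^ 2 ∂μ := by
  rw [enorm_sq_eq_lintegral, ← lintegral_indicator hs]
  refine lintegral_congr_ae ?_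
  filter_upwards [h] with ω hω
  rw [hω]
  by_cases h : ω ∈ s <;> simp [h]

end

/-! ### Pointwise consequences of invariance -/

section

variable {Ω H : Type*} [MeasurableSpace Ω] {μ : Measure Ω}
  [NormedAddCommGroup H] [InnerProductSpace ℂ H]

/-- Elements of an invariant subspace and of its orthogonal complement are pointwise
orthogonal. -/
theorem IsMulInvariant.ae_inner_eq_zero {D : Set (Lp ℂ ∞ μ)} (hD : IsDetermining D)
    {W : ClosedSubmodule ℂ (Lp H 2 μ)} (hW : IsMulInvariant D W) {φ ψ : Lp H 2 μ}
    (hφ : φ ∈ W.toSubmodule) (hψ : ψ ∈ W.toSubmoduleᗮ) :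
    ∀ᵐ ω ∂μ, inner ℂ (ψ ω) (φ ω) = 0 :=
  hD.ae_eq_zero (L2.integrable_inner ψ φ) fun g hg => by
    rw [← inner_lpSMul]
    exact Submodule.inner_left_of_mem_orthogonal (hW φ hφ g hg) hψ

/-- A bounded operator given by a range operator on `W` commutes with all multipliers. -/
theorem IsGivenBy.isMulPreserving {W : ClosedSubmodule ℂ (Lp H 2 μ)}
    {U : W.toSubmodule →L[ℂ] Lp H 2 μ} {J : Ω → ClosedSubmodule ℂ H} {R : RangeOperator J}
    (hR : IsGivenBy U R) {D : Set (Lp ℂ ∞ μ)} (hW : IsMulInvariant D W) :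
    IsMulPreserving D U := by
  refine ⟨hW, fun g hg φ => Lp.ext ?_⟩
  filter_upwards [hR φ, hR ⟨g • (φ : Lp H 2 μ), hW φ φ.2 g hg⟩,
    Lp.coeFn_lpSMul (r := 2) g (φ : Lp H 2 μ), Lp.coeFn_lpSMul (r := 2) g (U φ)] with ω h1 h2 h3 h4
  obtain ⟨hm1, h1⟩ := h1
  obtain ⟨hm2, h2⟩ := h2
  rw [h2, h4, Pi.smul_apply', h1, ← map_smul]
  congr 1
  exact Subtype.ext h3

theorem ae_norm_le_toReal_essSup {J : Ω → ClosedSubmodule ℂ H} {R : RangeOperator J}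
    (h : essSup (fun ω => ‖R ω‖ₑ) μ ≠ ∞) :
    ∀ᵐ ω ∂μ, ‖R ω‖ ≤ (essSup (fun ω => ‖R ω‖ₑ) μ).toReal := by
  filter_upwards [ENNReal.ae_le_essSup fun ω => ‖R ω‖ₑ] with ω hω
  exact (toReal_enorm (R ω)).symm.trans_le (ENNReal.toReal_mono h hω)

theorem norm_le_of_isGivenBy {W : ClosedSubmodule ℂ (Lp H 2 μ)}
    {U : W.toSubmodule →L[ℂ] Lp H 2 μ} {J : Ω → ClosedSubmodule ℂ H} {R : RangeOperator J}
    (hR : IsGivenBy U R) {C : ℝ} (hC0 : 0 ≤ C) (hC : ∀ᵐ ω ∂μ, ‖R ω‖ ≤ C) : ‖U‖ ≤ C := by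
  refine U.opNorm_le_bound hC0 fun φ => ?_
  refine Lp.norm_le_mul_norm_of_ae_le_mul ?_
  filter_upwards [hR φ, hC] with ω ⟨hm, h⟩ hω
  rw [h]
  exact (R ω).le_of_opNorm_le hω _

/-- Multiplying `φ` by the indicator of `s` and using the operator bound compares the integrals of
the squared norms over every measurable `s` of finite measure, hence the integrands. -/
theorem norm_apply_le_of_isMulPreserving [SigmaFinite μ] {W : ClosedSubmodule ℂ (Lp H 2 μ)}
    {U : W.toSubmodule →L[ℂ] Lp H 2 μ} (hU : IsMulPreserving Set.univ U) (φ : W.toSubmodule) :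
    ∀ᵐ ω ∂μ, ‖U φ ω‖ ≤ ‖U‖ * ‖(φ : Lp H 2 μ) ω‖ := by
  obtain ⟨hW, hU⟩ := hU
  have hle : (fun ω => ‖U φ ω‖ₑ ^ 2) ≤ᵐ[μ] fun ω => ‖U‖ₑ ^ 2 * ‖(φ : Lp H 2 μ) ω‖ₑ ^ 2 := by
    refine ae_le_of_forall_setLIntegral_le_of_sigmaFinite
      ((Lp.stronglyMeasurable _).enorm.pow_const 2) fun s hs _ => ?_
    obtain ⟨g, hg⟩ := exists_indicator_mul (μ := μ) (H := H) hs
    rw [lintegral_const_mul _ ((Lp.stronglyMeasurable _).enorm.pow_const 2),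
      ← enorm_sq_eq_setLIntegral hs (hg _), ← enorm_sq_eq_setLIntegral hs (hg _),
      ← hU g trivial φ, ← mul_pow]
    exact pow_le_pow_left₀ bot_le (U.le_opENorm _) 2
  filter_upwards [hle] with ω hω
  rw [← mul_pow, ENNReal.pow_le_pow_left_iff two_ne_zero] at hω
  have := ENNReal.toReal_mono (by finiteness) hω
  rwa [ENNReal.toReal_mul, toReal_enorm, toReal_enorm, toReal_enorm] at this

variable [CompleteSpace H]

theorem mem_of_forall_orthogonal {W : ClosedSubmodule ℂ (Lp H 2 μ)} {φ : Lp H 2 μ}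
    (h : ∀ ψ ∈ W.toSubmoduleᗮ, inner ℂ ψ φ = 0) : φ ∈ W.toSubmodule := by
  rw [← Submodule.orthogonal_orthogonal W.toSubmodule]
  exact (Submodule.mem_orthogonal _ _).2 h

theorem IsMulInvariant.univ {D : Set (Lp ℂ ∞ μ)} (hD : IsDetermining D)
    {W : ClosedSubmodule ℂ (Lp H 2 μ)} (hW : IsMulInvariant D W) :
    IsMulInvariant Set.univ W := fun φ hφ g _ =>
  mem_of_forall_orthogonal fun ψ hψ => by
    rw [inner_lpSMul]
    exact integral_inner_mul_eq_zero_of_ae g (hW.ae_inner_eq_zero hD hφ hψ)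

/-- For fixed `φ` and `χ`, the defect `⟨χ, U (g φ)⟩ - ⟨χ, g U φ⟩` is the integral of `g` against one
`L¹` function, built with the adjoint of `U`. It vanishes for `g ∈ D`, so that function is zero and
the defect vanishes for every `g`. -/
theorem IsMulPreserving.univ {D : Set (Lp ℂ ∞ μ)} (hD : IsDetermining D)
    {W : ClosedSubmodule ℂ (Lp H 2 μ)} {U : W.toSubmodule →L[ℂ] Lp H 2 μ}
    (hU : IsMulPreserving D U) : IsMulPreserving Set.univ U := by
  obtain ⟨hW, hU⟩ := hU
  have : CompleteSpace W.toSubmodule := W.isClosed.completeSpace_coe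
  have hdiff (φ : W.toSubmodule) (χ : Lp H 2 μ) (g : Lp ℂ ∞ μ)
      (hm : (g • (φ : Lp H 2 μ) : Lp H 2 μ) ∈ W.toSubmodule) :
      inner ℂ χ (U ⟨g • (φ : Lp H 2 μ), hm⟩) - inner ℂ χ (g • U φ : Lp H 2 μ) =
        ∫ ω, (inner ℂ ((U.adjoint χ : Lp H 2 μ) ω) ((φ : Lp H 2 μ) ω) -
          inner ℂ (χ ω) (U φ ω)) * g ω ∂μ := by
    rw [← ContinuousLinearMap.adjoint_inner_left, Submodule.coe_inner, inner_lpSMul, inner_lpSMul,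
      ← integral_sub]
    · simp only [sub_mul]
    · exact (L2.integrable_inner _ _).mul_of_top_left (Lp.memLp g)
    · exact (L2.integrable_inner _ _).mul_of_top_left (Lp.memLp g)
  refine ⟨hW.univ hD, fun g _ φ => ext_inner_left ℂ fun χ => ?_⟩
  have h0 := hD.ae_eq_zero
    ((L2.integrable_inner (U.adjoint χ : Lp H 2 μ) (φ : Lp H 2 μ)).sub
      (L2.integrable_inner χ (U φ))) fun g hg => by
        have := hdiff φ χ g (hW φ φ.2 g hg)
        rw [hU g hg φ, sub_self] at this
        exact this.symm
  rw [← sub_eq_zero, hdiff]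
  refine integral_eq_zero_of_ae ?_
  filter_upwards [h0] with ω hω
  simp only [Pi.sub_apply, Pi.zero_apply] at hω
  simp [hω]

theorem IsMeasurableRangeFunction.stronglyMeasurable [TopologicalSpace.SeparableSpace H]
    {J : Ω → ClosedSubmodule ℂ H} (hJ : IsMeasurableRangeFunction J) (a : H) :
    StronglyMeasurable fun ω => (J ω).toSubmodule.starProjection a :=
  stronglyMeasurable_of_inner fun b => hJ a b

/-- The functions `h P_J a`, for a fixed `h`, lie in the subspace with range function `J`. -/
theorem exists_generator [TopologicalSpace.SeparableSpace H]
    {J : Ω → ClosedSubmodule ℂ H} (hJ : IsMeasurableRangeFunction J)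
    {W : ClosedSubmodule ℂ (Lp H 2 μ)} (hJW : IsRangeFunctionOf J W)
    {h : Ω → ℝ} (hm : Measurable h) (hh : MemLp h 2 μ) (a : H) :
    ∃ ψ : W.toSubmodule, ∀ᵐ ω ∂μ,
      (ψ : Lp H 2 μ) ω = (h ω : ℂ) • (J ω).toSubmodule.starProjection a := by
  have hmem : MemLp (fun ω => (h ω : ℂ) • (J ω).toSubmodule.starProjection a) 2 μ := by
    refine MemLp.of_le_mul (c := ‖a‖) hh ?_ (ae_of_all _ fun ω => ?_)
    · exact (Complex.measurable_ofReal.comp hm).stronglyMeasurable.aestronglyMeasurable.smul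
        (hJ.stronglyMeasurable a).aestronglyMeasurable
    · rw [norm_smul, Complex.norm_real, mul_comm]
      exact mul_le_mul_of_nonneg_right (Submodule.norm_starProjection_apply_le _ _)
        (norm_nonneg _)
  refine ⟨⟨hmem.toLp _, (hJW _).2 ?_⟩, hmem.coeFn_toLp⟩
  filter_upwards [hmem.coeFn_toLp] with ω hω
  rw [hω]
  exact Submodule.smul_mem _ _ (Submodule.starProjection_apply_mem _ _)

theorem IsGivenBy.ae_apply_generator {W : ClosedSubmodule ℂ (Lp H 2 μ)}
    {U : W.toSubmodule →L[ℂ] Lp H 2 μ} {J : Ω → ClosedSubmodule ℂ H} {R : RangeOperator J}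
    (hR : IsGivenBy U R) {h : Ω → ℝ} {ψ : W.toSubmodule} {a : H}
    (hψ : ∀ᵐ ω ∂μ, (ψ : Lp H 2 μ) ω = (h ω : ℂ) • (J ω).toSubmodule.starProjection a) :
    ∀ᵐ ω ∂μ, U ψ ω = (h ω : ℂ) • R ω ((J ω).toSubmodule.orthogonalProjectionOnto a) := by
  filter_upwards [hR ψ, hψ] with ω ⟨hm, h1⟩ h2
  rw [h1, ← map_smul]
  congr 1
  exact Subtype.ext h2

end

/-! ### Range functions and range operators -/

section

variable {Ω H : Type*} [MeasurableSpace Ω] {μ : Measure Ω}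
  [NormedAddCommGroup H] [InnerProductSpace ℂ H]

/-- The closed linear span of a family of vectors. -/
def closedSpan {ι : Type*} (v : ι → H) : ClosedSubmodule ℂ H :=
  ⟨(Submodule.span ℂ (Set.range v)).topologicalClosure, Submodule.isClosed_topologicalClosure _⟩

theorem mem_closedSpan {ι : Type*} (v : ι → H) (i : ι) : v i ∈ (closedSpan v).toSubmodule :=
  Submodule.le_topologicalClosure _ (Submodule.subset_span ⟨i, rfl⟩)

theorem inner_eq_zero_of_mem_closedSpan {ι : Type*} {v : ι → H} {x y : H}
    (h : ∀ i, inner ℂ x (v i) = 0) (hy : y ∈ (closedSpan v).toSubmodule) : inner ℂ x y = 0 := by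
  rw [← Submodule.mem_orthogonal_singleton_iff_inner_right]
  refine Submodule.topologicalClosure_minimal _ ?_ (Submodule.isClosed_orthogonal _) hy
  rw [Submodule.span_le]
  rintro _ ⟨i, rfl⟩
  exact Submodule.mem_orthogonal_singleton_iff_inner_right.2 (h i)

variable [CompleteSpace H] [TopologicalSpace.SeparableSpace H]

theorem exists_rangeFunction [SigmaFinite μ] {D : Set (Lp ℂ ∞ μ)} (hD : IsDetermining D)
    {W : ClosedSubmodule ℂ (Lp H 2 μ)} (hW : IsMulInvariant D W) :
    ∃ J : Ω → ClosedSubmodule ℂ H, IsMeasurableRangeFunction J ∧ IsRangeFunctionOf J W := by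
  classical
  obtain ⟨h, hm, hpos, hh⟩ := exists_pos_memLp_two μ
  let d := TopologicalSpace.denseSeq H
  have hd : DenseRange d := TopologicalSpace.denseRange_denseSeq H
  have hmem (n : ℕ) : MemLp (fun ω => (h ω : ℂ) • d n) 2 μ := by
    refine MemLp.of_le_mul (c := ‖d n‖) hh ?_ (ae_of_all _ fun ω => ?_)
    · exact (Complex.measurable_ofReal.comp hm).stronglyMeasurable.aestronglyMeasurable.smul_const _
    · rw [norm_smul, Complex.norm_real, mul_comm]
  let e (n : ℕ) : Lp H 2 μ := (hmem n).toLp _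
  let φ (n : ℕ) : Lp H 2 μ := W.toSubmodule.starProjection (e n)
  have hφ (n : ℕ) : φ n ∈ W.toSubmodule := Submodule.starProjection_apply_mem _ _
  have hχ (n : ℕ) : e n - φ n ∈ W.toSubmoduleᗮ := Submodule.sub_starProjection_mem_orthogonal _
  let J₀ (ω : Ω) : ClosedSubmodule ℂ H := closedSpan fun n => φ n ω
  have hsub : ∀ᵐ ω ∂μ, ∀ n, (e n - φ n : Lp H 2 μ) ω = (h ω : ℂ) • d n - φ n ω := by
    refine ae_all_iff.2 fun n => ?_
    filter_upwards [Lp.coeFn_sub (e n) (φ n), (hmem n).coeFn_toLp] with ω h1 h2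
    rw [h1, Pi.sub_apply, h2]
  -- `h⁻¹ φ n` lies in `J₀ ω`, and `d n - h⁻¹ φ n = h⁻¹ (e n - φ n)` is orthogonal to it.
  have hproj : ∀ᵐ ω ∂μ, ∀ n,
      (J₀ ω).toSubmodule.starProjection (d n) = (h ω : ℂ)⁻¹ • φ n ω := by
    have horth : ∀ᵐ ω ∂μ, ∀ n m, inner ℂ ((e n - φ n : Lp H 2 μ) ω) (φ m ω) = 0 :=
      ae_all_iff.2 fun n => ae_all_iff.2 fun m => hW.ae_inner_eq_zero hD (hφ m) (hχ n)
    filter_upwards [hsub, horth] with ω h1 h2 n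
    have hne : (h ω : ℂ) ≠ 0 := Complex.ofReal_ne_zero.2 (hpos ω).ne'
    refine Submodule.eq_starProjection_of_mem_of_inner_eq_zero
      (Submodule.smul_mem _ _ (mem_closedSpan (fun n => φ n ω) n)) fun w hw => ?_
    have : d n - (h ω : ℂ)⁻¹ • φ n ω = (h ω : ℂ)⁻¹ • (e n - φ n : Lp H 2 μ) ω := by
      rw [h1, smul_sub, inv_smul_smul₀ hne]
    rw [this, inner_smul_left, inner_eq_zero_of_mem_closedSpan (fun m => h2 n m) hw, mul_zero]
  obtain ⟨S, hSae, hS, hSproj⟩ := hproj.exists_measurable_mem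
  -- Measurability is required everywhere, so `J` is reset to `⊥` off a measurable conull set.
  let J (ω : Ω) : ClosedSubmodule ℂ H := if ω ∈ S then J₀ ω else ⊥
  have hJ : ∀ ω ∈ S, J ω = J₀ ω := fun ω hω => if_pos hω
  refine ⟨J, ?_, fun ξ => ⟨fun hξ => ?_, fun hξ => ?_⟩⟩
  · refine measurable_inner_apply_of_denseRange
      (F := fun ω => (J ω).toSubmodule.starProjection) hd fun n b => ?_
    have : (fun ω => inner ℂ b ((J ω).toSubmodule.starProjection (d n))) =
        S.indicator fun ω => inner ℂ b ((h ω : ℂ)⁻¹ • φ n ω) := by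
      ext ω
      by_cases hω : ω ∈ S
      · rw [Set.indicator_of_mem hω, hJ ω hω, hSproj ω hω]
      · rw [Set.indicator_of_notMem hω]
        have : (J ω).toSubmodule = ⊥ := by simp [J, hω]
        have h0 : (J ω).toSubmodule.starProjection (d n) = 0 := by
          have hmem := Submodule.starProjection_apply_mem (J ω).toSubmodule (d n)
          generalize (J ω).toSubmodule.starProjection (d n) = x at hmem ⊢
          rwa [this, Submodule.mem_bot] at hmem
        rw [h0, inner_zero_right]
    rw [this]
    refine Measurable.indicator ?_ hS
    simp only [inner_smul_right]
    exact (Complex.measurable_ofReal.comp hm).inv.mul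
      (stronglyMeasurable_const.inner (Lp.stronglyMeasurable (φ n))).measurable
  · have horth : ∀ᵐ ω ∂μ, ∀ n, inner ℂ ((e n - φ n : Lp H 2 μ) ω) (ξ ω) = 0 :=
      ae_all_iff.2 fun n => hW.ae_inner_eq_zero hD hξ (hχ n)
    filter_upwards [hSae, hsub, horth] with ω hωS h1 h2
    have hne : (h ω : ℂ) ≠ 0 := Complex.ofReal_ne_zero.2 (hpos ω).ne'
    rw [hJ ω hωS, ← Submodule.starProjection_eq_self_iff]
    -- From `ξ ω ⊥ h (d n - P (d n))` one gets `⟨d n, ξ ω⟩ = ⟨P (d n), ξ ω⟩ = ⟨d n, P (ξ ω)⟩`; by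
    -- density `P` fixes `ξ ω`.
    have key : (fun x : H => inner ℂ x ((J₀ ω).toSubmodule.starProjection (ξ ω))) =
        fun x => inner ℂ x (ξ ω) := by
      refine hd.equalizer (by fun_prop) (by fun_prop) (funext fun n => ?_)
      have := h2 n
      rw [h1, ← smul_inv_smul₀ hne (φ n ω), ← hSproj ω hωS, ← smul_sub, inner_smul_left,
        inner_sub_left] at this
      have := (mul_eq_zero.1 this).resolve_left (by simpa using hne)
      rw [sub_eq_zero] at this
      simp only [Function.comp_apply]
      rw [this, Submodule.inner_starProjection_left_eq_right]
    exact ext_inner_left ℂ fun x => congrFun key x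
  · refine mem_of_forall_orthogonal fun ψ hψ => inner_eq_zero_of_ae ?_
    have horth : ∀ᵐ ω ∂μ, ∀ n, inner ℂ (ψ ω) (φ n ω) = 0 :=
      ae_all_iff.2 fun n => hW.ae_inner_eq_zero hD (hφ n) hψ
    filter_upwards [hSae, hξ, horth] with ω hωS h1 h2
    rw [hJ ω hωS] at h1
    exact inner_eq_zero_of_mem_closedSpan h2 h1

/-- A bounded operator commuting with all multipliers is given by a measurable range operator. -/
theorem exists_rangeOperator [SigmaFinite μ] {W : ClosedSubmodule ℂ (Lp H 2 μ)}
    {U : W.toSubmodule →L[ℂ] Lp H 2 μ} (hU : IsMulPreserving Set.univ U)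
    {J : Ω → ClosedSubmodule ℂ H} (hJ : IsMeasurableRangeFunction J)
    (hJW : IsRangeFunctionOf J W) :
    ∃ R : RangeOperator J, IsMeasurableRangeOperator R ∧ IsGivenBy U R := by
  classical
  obtain ⟨h, hm, hpos, hh⟩ := exists_pos_memLp_two μ
  have hne (ω : Ω) : (h ω : ℂ) ≠ 0 := Complex.ofReal_ne_zero.2 (hpos ω).ne'
  let d := TopologicalSpace.denseSeq H
  have hd : DenseRange d := TopologicalSpace.denseRange_denseSeq H
  choose ψ hψ using fun n => exists_generator hJ hJW hm hh (d n)
  let P (ω : Ω) : H →L[ℂ] H := (J ω).toSubmodule.starProjection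
  -- The value forced on `R ω (P ω (d n))`, since `ψ n = h P (d n)` a.e.
  let f (ω : Ω) (n : ℕ) : H := (h ω : ℂ)⁻¹ • U (ψ n) ω
  have hf : ∀ᵐ ω ∂μ, ∀ c ∈ ({0, 1, Complex.I} : Set ℂ), ∀ n m k,
      ‖f ω n + c • f ω m - f ω k‖ ≤ ‖U‖ * ‖P ω (d n + c • d m - d k)‖ := by
    refine (ae_ball_iff (Set.toFinite _).countable).2 fun c _ => ae_all_iff.2 fun n =>
      ae_all_iff.2 fun m => ae_all_iff.2 fun k => ?_
    filter_upwards [norm_apply_le_of_isMulPreserving hU (ψ n + c • ψ m - ψ k),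
      hψ n, hψ m, hψ k, Lp.coeFn_sub (U (ψ n) + c • U (ψ m)) (U (ψ k)),
      Lp.coeFn_add (U (ψ n)) (c • U (ψ m)), Lp.coeFn_smul c (U (ψ m)),
      Lp.coeFn_sub ((ψ n : Lp H 2 μ) + c • (ψ m : Lp H 2 μ)) (ψ k : Lp H 2 μ),
      Lp.coeFn_add (ψ n : Lp H 2 μ) (c • (ψ m : Lp H 2 μ)), Lp.coeFn_smul c (ψ m : Lp H 2 μ)]
      with ω h0 hn hm' hk h1 h2 h3 h4 h5 h6
    rw [map_sub, map_add, map_smul, h1, Pi.sub_apply, h2, Pi.add_apply, h3, Pi.smul_apply,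
      Submodule.coe_sub, Submodule.coe_add, Submodule.coe_smul, h4, Pi.sub_apply, h5,
      Pi.add_apply, h6, Pi.smul_apply, hn, hm', hk] at h0
    have e1 : f ω n + c • f ω m - f ω k =
        (h ω : ℂ)⁻¹ • (U (ψ n) ω + c • U (ψ m) ω - U (ψ k) ω) := by
      simp only [f, smul_sub, smul_add, smul_comm c]
    have e2 : P ω (d n + c • d m - d k) = (h ω : ℂ)⁻¹ • ((h ω : ℂ) • P ω (d n) +
        c • (h ω : ℂ) • P ω (d m) - (h ω : ℂ) • P ω (d k)) := by
      rw [smul_comm c, ← smul_add, ← smul_sub, inv_smul_smul₀ (hne ω), map_sub, map_add, map_smul]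
    rw [e1, e2, norm_smul, norm_smul, mul_left_comm]
    exact mul_le_mul_of_nonneg_left h0 (norm_nonneg _)
  obtain ⟨S, hSae, hS, hSf⟩ := hf.exists_measurable_mem
  have hT (ω : Ω) (hω : ω ∈ S) : ∃ T : H →L[ℂ] H, ∀ n, T (d n) = f ω n :=
    exists_continuousLinearMap_of_denseRange hd (f ω) ‖U‖ fun c hc n m k =>
      (hSf ω hω c hc n m k).trans (mul_le_mul_of_nonneg_left
        (Submodule.norm_starProjection_apply_le _ _) U.opNorm_nonneg)
  choose! T hT using hT
  -- `T ω` factors through `P ω`: the bound involves only `P ω (d n - y)`, which vanishes at `y = P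
  -- ω (d n)`.
  have hTP (ω : Ω) (hω : ω ∈ S) (n : ℕ) : T ω (P ω (d n)) = f ω n := by
    have hle (y : H) : ‖f ω n - T ω y‖ ≤ ‖U‖ * ‖P ω (d n - y)‖ :=
      hd.induction_on y (isClosed_le (by fun_prop) (by fun_prop)) fun k => by
        simpa [hT ω hω] using hSf ω hω 0 (by simp) n 0 k
    have := hle (P ω (d n))
    have h0 : P ω (d n - P ω (d n)) = 0 := by
      rw [map_sub, sub_eq_zero]
      exact (Submodule.starProjection_eq_self_iff.2
        (Submodule.starProjection_apply_mem _ _)).symm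
    rw [h0, norm_zero, mul_zero] at this
    exact (sub_eq_zero.1 (norm_le_zero_iff.1 this)).symm
  let R : RangeOperator J := fun ω =>
    if ω ∈ S then (T ω).comp (J ω).toSubmodule.subtypeL else 0
  have hR (ω : Ω) (hω : ω ∈ S) (x : (J ω).toSubmodule) : R ω x = T ω x := by
    simp [R, hω]
  refine ⟨R, ?_, fun φ => ?_⟩
  · refine measurable_inner_apply_of_denseRange
      (F := fun ω => (R ω).comp (J ω).toSubmodule.orthogonalProjectionOnto) hd fun n b => ?_
    have : (fun ω => inner ℂ b (((R ω).comp (J ω).toSubmodule.orthogonalProjectionOnto) (d n))) =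
        S.indicator fun ω => inner ℂ b (f ω n) := by
      ext ω
      by_cases hω : ω ∈ S
      · rw [Set.indicator_of_mem hω, ContinuousLinearMap.comp_apply, hR ω hω, ← hTP ω hω n]
        rfl
      · simp [hω, R]
    rw [this]
    refine Measurable.indicator ?_ hS
    simp only [f, inner_smul_right]
    exact (Complex.measurable_ofReal.comp hm).inv.mul
      (stronglyMeasurable_const.inner (Lp.stronglyMeasurable (U (ψ n)))).measurable
  · have hbd : ∀ᵐ ω ∂μ, ∀ n, ‖U φ ω - (h ω : ℂ) • f ω n‖ ≤
        ‖U‖ * ‖(φ : Lp H 2 μ) ω - (h ω : ℂ) • P ω (d n)‖ := by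
      refine ae_all_iff.2 fun n => ?_
      filter_upwards [norm_apply_le_of_isMulPreserving hU (φ - ψ n), hψ n,
        Lp.coeFn_sub (U φ) (U (ψ n)), Lp.coeFn_sub (φ : Lp H 2 μ) (ψ n : Lp H 2 μ)]
        with ω h0 h1 h2 h3
      rw [map_sub, h2, Pi.sub_apply, Submodule.coe_sub, h3, Pi.sub_apply, h1] at h0
      simpa only [f, smul_inv_smul₀ (hne ω)] using h0
    filter_upwards [hSae, (hJW φ).1 φ.2, hbd] with ω hω hmem hle
    refine ⟨hmem, ?_⟩
    rw [hR ω hω]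
    -- Comparing `φ` with each `ψ n` gives this bound on a dense set. At `x = h⁻¹ φ ω` the right
    -- side vanishes, because `P ω` fixes `φ ω`.
    have hle' (x : H) : ‖U φ ω - (h ω : ℂ) • T ω x‖ ≤
        ‖U‖ * ‖(φ : Lp H 2 μ) ω - (h ω : ℂ) • P ω x‖ :=
      hd.induction_on x (isClosed_le (by fun_prop) (by fun_prop)) fun k => by
        simpa [hT ω hω] using hle k
    have := hle' ((h ω : ℂ)⁻¹ • (φ : Lp H 2 μ) ω)
    rw [map_smul, map_smul, smul_inv_smul₀ (hne ω), smul_inv_smul₀ (hne ω),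
      show P ω ((φ : Lp H 2 μ) ω) = _ from Submodule.starProjection_eq_self_iff.2 hmem, sub_self,
      norm_zero, mul_zero] at this
    exact sub_eq_zero.1 (norm_le_zero_iff.1 this)

/-- An essentially bounded measurable range operator acts on `L²`. -/
theorem exists_isGivenBy {W : ClosedSubmodule ℂ (Lp H 2 μ)} {J : Ω → ClosedSubmodule ℂ H}
    (hJW : IsRangeFunctionOf J W) {R : RangeOperator J} (hR : IsMeasurableRangeOperator R)
    {C : ℝ} (hC : ∀ᵐ ω ∂μ, ‖R ω‖ ≤ C) :
    ∃ U : W.toSubmodule →L[ℂ] Lp H 2 μ, IsGivenBy U R := by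
  -- Precomposing with the projection extends `R` to all of `H`, so the operator can be built on all
  -- of `L²` and then restricted to `W`.
  let F (ω : Ω) : H →L[ℂ] H := (R ω).comp (J ω).toSubmodule.orthogonalProjectionOnto
  have hF : ∀ᵐ ω ∂μ, ∀ x, ‖F ω x‖ ≤ C * ‖x‖ := by
    filter_upwards [hC] with ω hω x
    exact ((R ω).le_of_opNorm_le hω _).trans (mul_le_mul_of_nonneg_left
      (Submodule.norm_orthogonalProjectionOnto_apply_le _ _) ((R ω).opNorm_nonneg.trans hω))
  have hle (φ : Lp H 2 μ) : ∀ᵐ ω ∂μ, ‖F ω (φ ω)‖ ≤ C * ‖φ ω‖ := hF.mono fun ω h => h _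
  have hmem (φ : Lp H 2 μ) : MemLp (fun ω => F ω (φ ω)) 2 μ :=
    MemLp.of_le_mul (Lp.memLp φ)
      (stronglyMeasurable_apply (F := F) hR (Lp.stronglyMeasurable φ)).aestronglyMeasurable (hle φ)
  let V : Lp H 2 μ →ₗ[ℂ] Lp H 2 μ :=
    { toFun := fun φ => (hmem φ).toLp _
      map_add' := fun φ χ => by
        refine Lp.ext ?_
        filter_upwards [(hmem (φ + χ)).coeFn_toLp, (hmem φ).coeFn_toLp, (hmem χ).coeFn_toLp,
          Lp.coeFn_add φ χ, Lp.coeFn_add ((hmem φ).toLp _) ((hmem χ).toLp _)] with ω h1 h2 h3 h4 h5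
        rw [h1, h5, Pi.add_apply, h2, h3, h4, Pi.add_apply, map_add]
      map_smul' := fun c φ => by
        refine Lp.ext ?_
        filter_upwards [(hmem (c • φ)).coeFn_toLp, (hmem φ).coeFn_toLp,
          Lp.coeFn_smul c φ, Lp.coeFn_smul c ((hmem φ).toLp _)] with ω h1 h2 h4 h5
        rw [RingHom.id_apply, h1, h5, Pi.smul_apply, h2, h4, Pi.smul_apply, map_smul] }
  have hV (φ : Lp H 2 μ) : ‖V φ‖ ≤ C * ‖φ‖ := by
    refine Lp.norm_le_mul_norm_of_ae_le_mul ?_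
    filter_upwards [(hmem φ).coeFn_toLp, hle φ] with ω h1 h2
    exact (congrArg norm h1).trans_le h2
  refine ⟨(V.mkContinuous C hV).comp W.toSubmodule.subtypeL, fun φ => ?_⟩
  filter_upwards [(hJW φ).1 φ.2, (hmem φ).coeFn_toLp] with ω hω h1
  refine ⟨hω, h1.trans ?_⟩
  change R ω ((J ω).toSubmodule.orthogonalProjectionOnto ((φ : Lp H 2 μ) ω)) = _
  congr 1
  exact Submodule.orthogonalProjectionOnto_mem_subspace_eq_self
    (⟨(φ : Lp H 2 μ) ω, hω⟩ : (J ω).toSubmodule)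

theorem ae_eq_of_isGivenBy [SigmaFinite μ] {W : ClosedSubmodule ℂ (Lp H 2 μ)}
    {U : W.toSubmodule →L[ℂ] Lp H 2 μ} {J : Ω → ClosedSubmodule ℂ H}
    (hJ : IsMeasurableRangeFunction J) (hJW : IsRangeFunctionOf J W) {R R' : RangeOperator J}
    (hR : IsGivenBy U R) (hR' : IsGivenBy U R') : ∀ᵐ ω ∂μ, R ω = R' ω := by
  obtain ⟨h, hm, hpos, hh⟩ := exists_pos_memLp_two μ
  have hd := TopologicalSpace.denseRange_denseSeq H
  choose ψ hψ using fun n => exists_generator hJ hJW hm hh (TopologicalSpace.denseSeq H n)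
  filter_upwards [ae_all_iff.2 fun n => hR.ae_apply_generator (hψ n),
    ae_all_iff.2 fun n => hR'.ae_apply_generator (hψ n)] with ω h1 h2
  have hne : (h ω : ℂ) ≠ 0 := Complex.ofReal_ne_zero.2 (hpos ω).ne'
  have heq := hd.equalizer
    ((R ω).comp (J ω).toSubmodule.orthogonalProjectionOnto).continuous
    ((R' ω).comp (J ω).toSubmodule.orthogonalProjectionOnto).continuous
    (funext fun n => smul_right_injective H hne ((h1 n).symm.trans (h2 n)))
  ext x
  simpa using congrFun heq (x : H)

/-- Dividing the pointwise bound for the functions `h P_J (d n)` by `h > 0` bounds `R ω` on the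
projections of a dense sequence; these are dense in `J ω`. -/
theorem ae_norm_le_of_isGivenBy [SigmaFinite μ] {W : ClosedSubmodule ℂ (Lp H 2 μ)}
    {U : W.toSubmodule →L[ℂ] Lp H 2 μ} {J : Ω → ClosedSubmodule ℂ H}
    (hJ : IsMeasurableRangeFunction J) (hJW : IsRangeFunctionOf J W)
    (hU : IsMulPreserving Set.univ U) {R : RangeOperator J} (hR : IsGivenBy U R) :
    ∀ᵐ ω ∂μ, ‖R ω‖ ≤ ‖U‖ := by
  obtain ⟨h, hm, hpos, hh⟩ := exists_pos_memLp_two μ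
  have hd := TopologicalSpace.denseRange_denseSeq H
  choose ψ hψ using fun n => exists_generator hJ hJW hm hh (TopologicalSpace.denseSeq H n)
  filter_upwards [ae_all_iff.2 fun n => hR.ae_apply_generator (hψ n),
    ae_all_iff.2 fun n => norm_apply_le_of_isMulPreserving hU (ψ n), ae_all_iff.2 hψ]
    with ω h1 h2 h3
  have hle (x : H) : ‖R ω ((J ω).toSubmodule.orthogonalProjectionOnto x)‖ ≤
      ‖U‖ * ‖(J ω).toSubmodule.orthogonalProjectionOnto x‖ := by
    refine hd.induction_on x (isClosed_le (by fun_prop) (by fun_prop)) fun n => ?_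
    have := h2 n
    rw [h1, h3, norm_smul, norm_smul, mul_left_comm, Complex.norm_real] at this
    exact le_of_mul_le_mul_left this (norm_pos_iff.2 (hpos ω).ne')
  exact (R ω).opNorm_le_bound U.opNorm_nonneg fun x => by simpa using hle (x : H)

end

end MulInvariant

/-! ### The main theorem -/

theorem theorem2p2 {Ω H : Type*} [MeasurableSpace Ω] (μ : Measure Ω) [SigmaFinite μ]
    [NormedAddCommGroup H] [InnerProductSpace ℂ H] [CompleteSpace H]
    [TopologicalSpace.SeparableSpace H]
    (D : Set (Lp ℂ ∞ μ)) (hD : MulInvariant.IsDetermining D)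
    (W : ClosedSubmodule ℂ (Lp H 2 μ)) (hW : MulInvariant.IsMulInvariant D W) :
    -- a corresponding measurable range function exists
    (∃ J : Ω → ClosedSubmodule ℂ H,
      MulInvariant.IsMeasurableRangeFunction J ∧ MulInvariant.IsRangeFunctionOf J W) ∧
    ∀ J : Ω → ClosedSubmodule ℂ H,
      MulInvariant.IsMeasurableRangeFunction J → MulInvariant.IsRangeFunctionOf J W →
      -- the three conditions on a bounded operator are equivalent
      (∀ U : W.toSubmodule →L[ℂ] Lp H 2 μ,
        List.TFAE [
          MulInvariant.IsMulPreserving D U,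
          MulInvariant.IsMulPreserving Set.univ U,
          ∃ R : MulInvariant.RangeOperator J,
            MulInvariant.IsMeasurableRangeOperator R ∧ MulInvariant.IsGivenBy U R]) ∧
      -- every essentially bounded measurable range operator arises
      (∀ R : MulInvariant.RangeOperator J, MulInvariant.IsMeasurableRangeOperator R →
        essSup (fun ω => ‖R ω‖ₑ) μ < ∞ →
        ∃ U : W.toSubmodule →L[ℂ] Lp H 2 μ,
          MulInvariant.IsMulPreserving D U ∧ MulInvariant.IsGivenBy U R) ∧
      -- the correspondence is one to one, range operators being identified if equal a.e.
      (∀ (U U' : W.toSubmodule →L[ℂ] Lp H 2 μ) (R R' : MulInvariant.RangeOperator J),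
        MulInvariant.IsMeasurableRangeOperator R → MulInvariant.IsMeasurableRangeOperator R' →
        MulInvariant.IsGivenBy U R → MulInvariant.IsGivenBy U' R' →
        (U = U' ↔ ∀ᵐ ω ∂μ, R ω = R' ω)) ∧
      -- the operator norm is the essential supremum of the norms
      (∀ (U : W.toSubmodule →L[ℂ] Lp H 2 μ) (R : MulInvariant.RangeOperator J),
        MulInvariant.IsMeasurableRangeOperator R → MulInvariant.IsGivenBy U R →
        ‖U‖ₑ = essSup (fun ω => ‖R ω‖ₑ) μ) := by
  refine ⟨MulInvariant.exists_rangeFunction hD hW, fun J hJ hJW => ⟨fun U => ?_, fun R hR hess => ?_,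
    fun U U' R R' _ _ hUR hUR' => ⟨fun h => ?_, fun h => ?_⟩, fun U R _ hUR => ?_⟩⟩
  · tfae_have 1 → 2 := fun h => h.univ hD
    tfae_have 2 → 3 := fun h => MulInvariant.exists_rangeOperator h hJ hJW
    tfae_have 3 → 1 := fun ⟨_, _, h⟩ => h.isMulPreserving hW
    tfae_finish
  · obtain ⟨U, hU⟩ :=
      MulInvariant.exists_isGivenBy hJW hR (MulInvariant.ae_norm_le_toReal_essSup hess.ne)
    exact ⟨U, hU.isMulPreserving hW, hU⟩
  · subst h
    exact MulInvariant.ae_eq_of_isGivenBy hJ hJW hUR hUR'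
  · ext1 φ
    refine Lp.ext ?_
    filter_upwards [h, hUR φ, hUR' φ] with ω hω ⟨h1, h2⟩ ⟨h3, h4⟩
    rw [h2, h4, hω]
  · refine le_antisymm ?_ (essSup_le_of_ae_le _ ?_)
    · by_cases hess : essSup (fun ω => ‖R ω‖ₑ) μ = ∞
      · exact hess ▸ le_top
      · rw [← ofReal_norm, ENNReal.ofReal_le_iff_le_toReal hess]
        exact MulInvariant.norm_le_of_isGivenBy hUR ENNReal.toReal_nonneg
          (MulInvariant.ae_norm_le_toReal_essSup hess)
    · filter_upwards [MulInvariant.ae_norm_le_of_isGivenBy hJ hJW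
        (hUR.isMulPreserving (hW.univ hD)) hUR] with ω hω
      exact enorm_le_iff_norm_le.2 hω
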